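/- Let $\Bbbk$ be a field of prime characteristic $p$, let $n>1$ be an integer with $p\mid n-1$, and let $c\in\Bbbk$, $c\neq 0$. Let $S_n$ act on $V=\bigoplus_{i=1}^n\Bbbk y_i$ and on $V^*$ (dual basis $x_1,\dots,x_n$) by permuting the basis vectors, and put $\mathfrak h=\mathrm{Span}\{y_i-y_j\}\subset V$ and $\mathfrak h^*=V^*/(x_1+\dots+x_n)$. Write $\sigma_{ij}\in S_n$ for the transposition of $i$ and $j$. Let $\mathcal H_{0,c}=\mathcal H_{0,c}(S_n,\mathfrak h)$ be the rational Cherednik algebra of type $A_{n-1}$ at $t=0$, that is, the quotient of $\Bbbk S_n\ltimes T(\mathfrak h\oplus\mathfrak h^*)$ by the relations $[x_i,x_j]=0$, $[y_i-y_j,y_l-y_m]=0$, $[y_i-y_j,x_i]=-c\,\sigma_{ij}-c\sum_{l\ne i}\sigma_{il}$ for $i\neq j$, and $[y_i-y_j,x_l]=c\,\sigma_{il}-c\,\sigma_{jl}$ for $l\neq i,j$. It acts on $S\mathfrak h^*=\Bbbk[x_1,\dots,x_n]/(x_1+\dots+x_n)$ (the polynomial representation) with $S_n$ acting naturally, $x\in\mathfrak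 h^*$ acting by multiplication, and $y_i-y_j$ acting by the Dunkl operator $D_{y_i}-D_{y_j}$, where $D_{y_i}=-c\sum_{l\ne i}(x_i-x_l)^{-1}(1-\sigma_{il})$. Let $f\mapsto f(D)$ be the extension of $y\mapsto D_y$ to an algebra homomorphism $S\mathfrak h\to\mathrm{End}(S\mathfrak h^*)$, let $\mathcal B(f,q)$, for $f\in S\mathfrak h$ and $q\in S\mathfrak h^*$, be the constant term of $f(D)q$ (the contravariant form), and let $$\mathcal L_{0,c}=S\mathfrak h^*/\ker\mathcal B,\qquad \ker\mathcal B=\{q\in S\mathfrak h^* : \mathcal B(f,q)=0\ \text{for all } f\in S\mathfrak h\}.$$ Let $\mathcal L_{0,c}[i]$ be the image in $\mathcal L_{0,c}$ of the homogeneous polynomials of degree $i$. Then $\mathcal L_{0,c}$ is an irreducible $\mathcal H_{0,c}$-module, $\mathcal L_{0,c}=\bigoplus_{i\ge0}\mathcal L_{0,c}[i]$, and its Hilbert series is $$h_{\mathcal L_{0,c}}(z)=\sum_{i\ge 0}\dim\mathcal L_{0,c}[i]\,z^i=\left(\frac{1-z^p}{1-z}\right)\left(1+(n-2)z+z^2\right).$$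 In particular, this equals the series $[r]_z!\,[p]_z\,Q_r(n,z)$ conjectured by Etingof and Rains, where $r$ is the residue of $n$ modulo $p$ (here $r=1$), $[m]_z=\frac{1-z^m}{1-z}$, $[r]_z!=[r]_z[r-1]_z\cdots[1]_z$, and $Q_r(n,z)=\binom{n-1}{r-1}z^{r+1}+\sum_{i=0}^{r}\binom{n-r-2+i}{i}z^i$. -/

import Mathlib

noncomputable section

namespace RationalCherednik

open MvPolynomial

section Algebra

variable (k : Type*) [Field k] (n : ℕ)

/-- The reflection representation `𝔥 = Span {y_i - y_j}` inside the permutation representation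
`V = k^n` with basis `y_1, …, y_n`. -/
def hSub : Submodule k (Fin n → k) :=
  Submodule.span k (Set.range fun ij : Fin n × Fin n =>
    (Pi.single ij.1 1 - Pi.single ij.2 1 : Fin n → k))

/-- The vector `y_i - y_j` of `𝔥`. -/
def yDiff (i j : Fin n) : hSub k n :=
  ⟨Pi.single i 1 - Pi.single j 1, Submodule.subset_span ⟨(i, j), rfl⟩⟩

/-- The dual `𝔥^* = V^* / (x_1 + ⋯ + x_n)`. -/
abbrev HDual : Type _ := (Fin n → k) ⧸ Submodule.span k {(fun _ => 1 : Fin n → k)}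

/-- The class of `x_i` in `𝔥^*`. -/
def xBar (i : Fin n) : HDual k n := Submodule.Quotient.mk (Pi.single i 1)

/-- Generators of `k S_n ⋉ T(𝔥 ⊕ 𝔥^*)`. -/
inductive Gen : Type _
  | perm (σ : Equiv.Perm (Fin n)) : Gen
  | y (v : hSub k n) : Gen
  | x (w : HDual k n) : Gen

variable {k n}

/-- The element of the free algebra given by a permutation. -/
abbrev gPerm (σ : Equiv.Perm (Fin n)) : FreeAlgebra k (Gen k n) := FreeAlgebra.ι k (Gen.perm σ)

/-- The element of the free algebra given by a vector of `𝔥`. -/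
abbrev gY (v : hSub k n) : FreeAlgebra k (Gen k n) := FreeAlgebra.ι k (Gen.y v)

/-- The element of the free algebra given by a vector of `𝔥^*`. -/
abbrev gX (w : HDual k n) : FreeAlgebra k (Gen k n) := FreeAlgebra.ι k (Gen.x w)

/-- The relations of the rational Cherednik algebra. The first eight present the algebra
`k S_n ⋉ T(𝔥 ⊕ 𝔥^*)`; the last four are the defining commutation relations. -/
inductive Rel (t c : k) : FreeAlgebra k (Gen k n) → FreeAlgebra k (Gen k n) → Prop
  | y_add (v w : hSub k n) : Rel t c (gY (v + w)) (gY v + gY w)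
  | y_smul (a : k) (v : hSub k n) : Rel t c (gY (a • v)) (a • gY v)
  | x_add (v w : HDual k n) : Rel t c (gX (v + w)) (gX v + gX w)
  | x_smul (a : k) (v : HDual k n) : Rel t c (gX (a • v)) (a • gX v)
  | perm_one : Rel t c (gPerm 1) 1
  | perm_mul (σ τ : Equiv.Perm (Fin n)) : Rel t c (gPerm (σ * τ)) (gPerm σ * gPerm τ)
  | perm_y (σ : Equiv.Perm (Fin n)) (i j : Fin n) :
      Rel t c (gPerm σ * gY (yDiff k n i j)) (gY (yDiff k n (σ i) (σ j)) * gPerm σ)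
  | perm_x (σ : Equiv.Perm (Fin n)) (i : Fin n) :
      Rel t c (gPerm σ * gX (xBar k n i)) (gX (xBar k n (σ i)) * gPerm σ)
  | x_comm (v w : HDual k n) : Rel t c (gX v * gX w) (gX w * gX v)
  | y_comm (v w : hSub k n) : Rel t c (gY v * gY w) (gY w * gY v)
  | cross_self (i j : Fin n) (hij : i ≠ j) :
      Rel t c
        (gY (yDiff k n i j) * gX (xBar k n i) - gX (xBar k n i) * gY (yDiff k n i j))
        (algebraMap k _ t - c • gPerm (Equiv.swap i j)
          - c • ∑ l ∈ Finset.univ.erase i, gPerm (Equiv.swap i l))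
  | cross_other (i j l : Fin n) (hi : l ≠ i) (hj : l ≠ j) :
      Rel t c
        (gY (yDiff k n i j) * gX (xBar k n l) - gX (xBar k n l) * gY (yDiff k n i j))
        (c • gPerm (Equiv.swap i l) - c • gPerm (Equiv.swap j l))

variable (k n)

/-- The rational Cherednik algebra `H_{t,c}(S_n, 𝔥)` of type `A_{n-1}`. -/
abbrev CherednikAlgebra (t c : k) : Type _ := RingQuot (Rel (k := k) (n := n) t c)

end Algebra

section Dunkl

variable {k : Type*} [Field k] {n : ℕ}

theorem dvd_sub_swap (i j : Fin n) (f : MvPolynomial (Fin n) k) :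
    (X i - X j : MvPolynomial (Fin n) k) ∣ f - rename (Equiv.swap i j) f := by
  induction f using MvPolynomial.induction_on with
  | C a => simp
  | add p q hp hq =>
    rw [map_add, add_sub_add_comm]
    exact dvd_add hp hq
  | mul_X p l hp =>
    have h : p * X l - rename (Equiv.swap i j) (p * X l)
        = (p - rename (Equiv.swap i j) p) * X l
          + rename (Equiv.swap i j) p * (X l - X (Equiv.swap i j l)) := by
      rw [map_mul, rename_X]; ring
    rw [h]
    refine dvd_add (hp.mul_right _) (Dvd.dvd.mul_left ?_ _)
    rcases eq_or_ne l i with rfl | hi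
    · simp
    · rcases eq_or_ne l j with rfl | hj
      · rw [Equiv.swap_apply_right]
        exact ⟨-1, by ring⟩
      · simp [Equiv.swap_apply_of_ne_of_ne hi hj]

/-- The quotient `(f - σ_ij f) / (x_i - x_j)` for `i ≠ j` (and `0` for `i = j`). -/
def divDiffFun (i j : Fin n) (f : MvPolynomial (Fin n) k) : MvPolynomial (Fin n) k :=
  if i = j then 0 else Classical.choose (dvd_sub_swap i j f)

theorem divDiffFun_spec (i j : Fin n) (hij : i ≠ j) (f : MvPolynomial (Fin n) k) :
    (X i - X j) * divDiffFun i j f = f - rename (Equiv.swap i j) f := by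
  rw [divDiffFun, if_neg hij]
  exact (Classical.choose_spec (dvd_sub_swap i j f)).symm

theorem X_sub_X_ne_zero (i j : Fin n) (hij : i ≠ j) :
    (X i - X j : MvPolynomial (Fin n) k) ≠ 0 :=
  sub_ne_zero.mpr fun h => hij (X_injective h)

/-- The operator `(x_i - x_j)^{-1} (1 - σ_ij)` on `k[x_1, …, x_n]`, for `i ≠ j`. -/
def divDiff (i j : Fin n) : Module.End k (MvPolynomial (Fin n) k) where
  toFun := divDiffFun i j
  map_add' f g := by
    by_cases hij : i = j
    · simp [divDiffFun, hij]
    · apply mul_left_cancel₀ (X_sub_X_ne_zero (k := k) i j hij)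
      rw [mul_add, divDiffFun_spec i j hij, divDiffFun_spec i j hij, divDiffFun_spec i j hij,
        map_add]
      ring
  map_smul' a f := by
    by_cases hij : i = j
    · simp [divDiffFun, hij]
    · apply mul_left_cancel₀ (X_sub_X_ne_zero (k := k) i j hij)
      rw [RingHom.id_apply, mul_smul_comm, divDiffFun_spec i j hij, divDiffFun_spec i j hij,
        map_smul, smul_sub]

theorem divDiff_spec (i j : Fin n) (hij : i ≠ j) (f : MvPolynomial (Fin n) k) :
    (X i - X j) * divDiff i j f = f - rename (Equiv.swap i j) f :=
  divDiffFun_spec i j hij f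

/-- The Dunkl operator `D_{y_i} = t ∂_i - c ∑_{j ≠ i} (x_i - x_j)^{-1} (1 - σ_ij)` on
`k[x_1, …, x_n]`. -/
def dunklV (t c : k) (i : Fin n) : Module.End k (MvPolynomial (Fin n) k) :=
  t • (pderiv i : Derivation k _ _).toLinearMap - c • ∑ j ∈ Finset.univ.erase i, divDiff i j

theorem dunklV_apply (t c : k) (i : Fin n) (f : MvPolynomial (Fin n) k) :
    dunklV t c i f = t • pderiv i f - c • ∑ j ∈ Finset.univ.erase i, divDiff i j f := by
  simp [dunklV]

theorem divDiff_X_mul (i j : Fin n) (hij : i ≠ j) (l : Fin n) (f : MvPolynomial (Fin n) k) :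
    divDiff i j (X l * f) = X l * divDiff i j f
      + (if l = i then rename (Equiv.swap i j) f else 0)
      - (if l = j then rename (Equiv.swap i j) f else 0) := by
  apply mul_left_cancel₀ (X_sub_X_ne_zero (k := k) i j hij)
  rw [divDiff_spec i j hij, mul_sub, mul_add, mul_left_comm, divDiff_spec i j hij, map_mul,
    rename_X]
  rcases eq_or_ne l i with rfl | hi
  · rw [if_pos rfl, if_neg hij, Equiv.swap_apply_left]; ring
  · rcases eq_or_ne l j with rfl | hj
    · rw [if_neg hi, if_pos rfl, Equiv.swap_apply_right]; ring
    · rw [if_neg hi, if_neg hj, Equiv.swap_apply_of_ne_of_ne hi hj]; ring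

theorem divDiff_rename (σ : Equiv.Perm (Fin n)) (i j : Fin n) (f : MvPolynomial (Fin n) k) :
    divDiff (σ i) (σ j) (rename σ f) = rename σ (divDiff i j f) := by
  by_cases hij : i = j
  · subst hij; simp [divDiff, divDiffFun]
  have hσ : σ i ≠ σ j := fun h => hij (σ.injective h)
  apply mul_left_cancel₀ (X_sub_X_ne_zero (k := k) _ _ hσ)
  have h := congrArg (rename σ) (divDiff_spec i j hij f)
  rw [map_mul, map_sub, rename_X, rename_X] at h
  rw [h, divDiff_spec _ _ hσ, map_sub, rename_rename, rename_rename]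
  congr 3
  funext l
  simp [Equiv.swap_apply_def, apply_ite σ, σ.injective.eq_iff]

theorem pderiv_rename_perm (σ : Equiv.Perm (Fin n)) (i : Fin n) (f : MvPolynomial (Fin n) k) :
    pderiv (σ i) (rename σ f) = rename σ (pderiv i f) :=
  pderiv_rename σ.injective i f

theorem dunklV_rename (t c : k) (σ : Equiv.Perm (Fin n)) (i : Fin n)
    (f : MvPolynomial (Fin n) k) :
    dunklV t c (σ i) (rename σ f) = rename σ (dunklV t c i f) := by
  rw [dunklV_apply, dunklV_apply, map_sub, map_smul, map_smul, map_sum, pderiv_rename_perm]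
  congr 2
  refine (Finset.sum_bij (fun j _ => σ j) ?_ ?_ ?_ ?_).symm
  · intro j hj; simpa using hj
  · intro a _ b _ h; exact σ.injective h
  · intro b hb
    refine ⟨σ.symm b, ?_, by simp⟩
    simp only [Finset.mem_erase, Finset.mem_univ, and_true] at hb ⊢
    rintro rfl; simp at hb
  · intro j _; exact (divDiff_rename σ i j f).symm

theorem dunklV_X_mul_self (t c : k) (i : Fin n) (f : MvPolynomial (Fin n) k) :
    dunklV t c i (X i * f) = X i * dunklV t c i f + t • f
      - c • ∑ l ∈ Finset.univ.erase i, rename (Equiv.swap i l) f := by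
  have h : ∑ l ∈ Finset.univ.erase i, divDiff i l (X i * f)
      = X i * ∑ l ∈ Finset.univ.erase i, divDiff i l f
        + ∑ l ∈ Finset.univ.erase i, rename (Equiv.swap i l) f := by
    rw [Finset.mul_sum, ← Finset.sum_add_distrib]
    refine Finset.sum_congr rfl fun l hl => ?_
    have hl' : i ≠ l := (Finset.ne_of_mem_erase hl).symm
    rw [divDiff_X_mul i l hl', if_pos rfl, if_neg hl', sub_zero]
  rw [dunklV_apply, dunklV_apply, h, Derivation.leibniz, pderiv_X_self]
  simp only [smul_eq_mul, mul_one, smul_add, mul_sub, mul_smul_comm]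
  ring

theorem dunklV_X_mul_of_ne (t c : k) (i l : Fin n) (hl : l ≠ i) (f : MvPolynomial (Fin n) k) :
    dunklV t c i (X l * f) = X l * dunklV t c i f + c • rename (Equiv.swap i l) f := by
  have h : ∑ j ∈ Finset.univ.erase i, divDiff i j (X l * f)
      = X l * ∑ j ∈ Finset.univ.erase i, divDiff i j f - rename (Equiv.swap i l) f := by
    have h2 : ∀ j ∈ Finset.univ.erase i, divDiff i j (X l * f)
        = X l * divDiff i j f - (if l = j then rename (Equiv.swap i j) f else 0) := by
      intro j hj
      rw [divDiff_X_mul i j (Finset.ne_of_mem_erase hj).symm, if_neg hl, add_zero]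
    rw [Finset.sum_congr rfl h2, Finset.sum_sub_distrib, ← Finset.mul_sum,
      Finset.sum_ite_eq, if_pos (by simp [hl])]
  rw [dunklV_apply, dunklV_apply, h, Derivation.leibniz, pderiv_X_of_ne hl]
  simp only [smul_eq_mul, mul_zero, add_zero, mul_sub, mul_smul_comm, smul_sub]
  ring

theorem dunklV_C (t c : k) (i : Fin n) (a : k) : dunklV t c i (C a) = 0 := by
  rw [dunklV_apply]
  have h : ∀ j ∈ Finset.univ.erase i, divDiff i j (C a : MvPolynomial (Fin n) k) = 0 := by
    intro j hj
    have hij := (Finset.ne_of_mem_erase hj).symm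
    apply mul_left_cancel₀ (X_sub_X_ne_zero (k := k) i j hij)
    rw [divDiff_spec i j hij]; simp
  rw [Finset.sum_congr rfl h]
  simp

theorem dunklV_swap (t c : k) (i j : Fin n) (f : MvPolynomial (Fin n) k) :
    dunklV t c i (rename (Equiv.swap i j) f) = rename (Equiv.swap i j) (dunklV t c j f) := by
  have h := dunklV_rename t c (Equiv.swap i j) j f
  rwa [Equiv.swap_apply_right] at h

theorem dunklV_swap_of_ne (t c : k) (i j l : Fin n) (hi : i ≠ j) (hl : i ≠ l)
    (f : MvPolynomial (Fin n) k) :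
    dunklV t c i (rename (Equiv.swap j l) f) = rename (Equiv.swap j l) (dunklV t c i f) := by
  have h := dunklV_rename t c (Equiv.swap j l) i f
  rwa [Equiv.swap_apply_of_ne_of_ne hi hl] at h

/-- The Dunkl operators commute. -/
theorem dunklV_comm (t c : k) (i j : Fin n) (f : MvPolynomial (Fin n) k) :
    dunklV t c i (dunklV t c j f) = dunklV t c j (dunklV t c i f) := by
  rcases eq_or_ne i j with rfl | hij
  · rfl
  have key : ∀ (i j : Fin n), i ≠ j → ∀ f : MvPolynomial (Fin n) k,
      dunklV t c i (dunklV t c j f) = dunklV t c j (dunklV t c i f) →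
      dunklV t c i (dunklV t c j (X i * f)) = dunklV t c j (dunklV t c i (X i * f)) := by
    intro i j hij f hf
    rw [dunklV_X_mul_of_ne t c j i hij, dunklV_X_mul_self t c i f, map_add, map_sub, map_add,
      map_smul, map_smul, map_smul, map_sum, dunklV_X_mul_self, dunklV_X_mul_of_ne t c j i hij, hf,
      Equiv.swap_comm j i, dunklV_swap t c i j]
    have hmem : j ∈ Finset.univ.erase i := by simp [hij.symm]
    rw [← Finset.add_sum_erase _ _ hmem, ← Finset.add_sum_erase _ _ hmem]
    have h1 : dunklV t c j (rename (Equiv.swap i j) f)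
        = rename (Equiv.swap i j) (dunklV t c i f) := by
      rw [Equiv.swap_comm i j]; exact dunklV_swap t c j i f
    have h2 : ∀ l ∈ (Finset.univ.erase i).erase j, dunklV t c j (rename (Equiv.swap i l) f)
        = rename (Equiv.swap i l) (dunklV t c j f) := by
      intro l hl
      exact dunklV_swap_of_ne t c j i l hij.symm (Finset.ne_of_mem_erase hl).symm f
    rw [h1, Finset.sum_congr rfl h2, smul_add, smul_add]
    ring
  induction f using MvPolynomial.induction_on with
  | C a => simp [dunklV_C]
  | add p q hp hq => simp only [map_add, hp, hq]
  | mul_X p l hp =>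
    rw [mul_comm p (X l)]
    rcases eq_or_ne l i with rfl | hi
    · exact key l j hij p hp
    · rcases eq_or_ne l j with rfl | hj
      · exact (key l i hij.symm p hp.symm).symm
      · rw [dunklV_X_mul_of_ne t c j l hj, dunklV_X_mul_of_ne t c i l hi, map_add, map_add,
          map_smul, map_smul, dunklV_X_mul_of_ne t c j l hj, dunklV_X_mul_of_ne t c i l hi, hp,
          dunklV_swap_of_ne t c i j l hij hi.symm, dunklV_swap_of_ne t c j i l hij.symm hj.symm]
        ring

end Dunkl

section Representation

variable (k : Type*) [Field k] (n : ℕ)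

/-- The ideal `(x_1 + ⋯ + x_n)` of `k[x_1, …, x_n]`. -/
def sumIdeal : Ideal (MvPolynomial (Fin n) k) := Ideal.span {∑ i, X i}

/-- `S𝔥^* = k[x_1, …, x_n] / (x_1 + ⋯ + x_n)`, the space of the polynomial representation. -/
abbrev SymHDual : Type _ := MvPolynomial (Fin n) k ⧸ sumIdeal k n

variable {k n}

theorem mk_surj : Function.Surjective (Ideal.Quotient.mk (sumIdeal k n)) :=
  Ideal.Quotient.mk_surjective

/-- The operator induced on `S𝔥^*` by an operator on `k[x_1, …, x_n]` preserving the ideal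
`(x_1 + ⋯ + x_n)`. -/
def descend (T : Module.End k (MvPolynomial (Fin n) k))
    (hT : ∀ f ∈ sumIdeal k n, T f ∈ sumIdeal k n) : Module.End k (SymHDual k n) :=
  (((sumIdeal k n).restrictScalars k).liftQ
    ((Ideal.Quotient.mkₐ k (sumIdeal k n)).toLinearMap ∘ₗ T) (fun f hf => by
      simpa [Ideal.Quotient.eq_zero_iff_mem] using hT f hf)) ∘ₗ
    (Submodule.Quotient.restrictScalarsEquiv k (sumIdeal k n)).symm.toLinearMap

theorem descend_mk (T : Module.End k (MvPolynomial (Fin n) k))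
    (hT : ∀ f ∈ sumIdeal k n, T f ∈ sumIdeal k n) (f : MvPolynomial (Fin n) k) :
    descend T hT (Ideal.Quotient.mk _ f) = Ideal.Quotient.mk _ (T f) := rfl

theorem rename_sum_X (σ : Equiv.Perm (Fin n)) :
    rename σ (∑ i, X i : MvPolynomial (Fin n) k) = ∑ i, X i := by
  rw [map_sum]
  simp only [rename_X]
  exact Equiv.sum_comp σ (fun i => (X i : MvPolynomial (Fin n) k))

/-- The natural action of `S_n` on `S𝔥^*`: `σ x_i = x_{σ i}`. -/
def permOp (σ : Equiv.Perm (Fin n)) : Module.End k (SymHDual k n) :=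
  descend (rename σ).toLinearMap (fun f hf => by
    obtain ⟨g, rfl⟩ := Ideal.mem_span_singleton'.mp hf
    rw [AlgHom.toLinearMap_apply, map_mul, rename_sum_X]
    exact Ideal.mul_mem_left _ _ (Ideal.subset_span rfl))

theorem permOp_mk (σ : Equiv.Perm (Fin n)) (f : MvPolynomial (Fin n) k) :
    permOp σ (Ideal.Quotient.mk _ f) = Ideal.Quotient.mk _ (rename σ f) := rfl

theorem sum_eq_zero_of_mem_hSub {v : Fin n → k} (hv : v ∈ hSub k n) : ∑ i, v i = 0 := by
  induction hv using Submodule.span_induction with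
  | mem x hx =>
    obtain ⟨⟨i, j⟩, rfl⟩ := hx
    simp [Finset.sum_sub_distrib]
  | zero => simp
  | add x y _ _ hx hy => simp [Finset.sum_add_distrib, hx, hy]
  | smul a x _ hx => simp [← Finset.mul_sum, hx]

theorem dunklV_sum_mul (t c : k) (i : Fin n) (f : MvPolynomial (Fin n) k) :
    dunklV t c i (f * ∑ j, X j) = dunklV t c i f * ∑ j, X j + t • f := by
  have hmem : i ∈ (Finset.univ : Finset (Fin n)) := Finset.mem_univ i
  rw [mul_comm f, mul_comm (dunklV t c i f), Finset.sum_mul, Finset.sum_mul, map_sum,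
    ← Finset.add_sum_erase _ _ hmem, ← Finset.add_sum_erase _ _ hmem, dunklV_X_mul_self,
    Finset.sum_congr rfl fun l hl => dunklV_X_mul_of_ne t c i l (Finset.ne_of_mem_erase hl) f,
    Finset.sum_add_distrib, Finset.smul_sum]
  ring

/-- For `y = ∑ v_i y_i` in `𝔥`, the Dunkl operator `D_y = ∑ v_i D_{y_i}` on `S𝔥^*`. -/
def dunklFun (t c : k) (v : hSub k n) : Module.End k (SymHDual k n) :=
  descend (∑ i, (v : Fin n → k) i • dunklV t c i) (fun f hf => by
    obtain ⟨g, rfl⟩ := Ideal.mem_span_singleton'.mp hf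
    have h : (∑ i, (v : Fin n → k) i • dunklV t c i) (g * ∑ j, X j)
        = (∑ i, (v : Fin n → k) i • dunklV t c i g) * ∑ j, X j
          + (∑ i, (v : Fin n → k) i) • t • g := by
      rw [LinearMap.sum_apply, Finset.sum_mul, Finset.sum_smul, ← Finset.sum_add_distrib]
      refine Finset.sum_congr rfl fun i _ => ?_
      rw [LinearMap.smul_apply, dunklV_sum_mul, smul_add, smul_mul_assoc]
    rw [h, sum_eq_zero_of_mem_hSub v.2, zero_smul, add_zero]
    exact Ideal.mul_mem_left _ _ (Ideal.subset_span rfl))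

theorem dunklFun_mk (t c : k) (v : hSub k n) (f : MvPolynomial (Fin n) k) :
    dunklFun t c v (Ideal.Quotient.mk _ f)
      = Ideal.Quotient.mk _ (∑ i, (v : Fin n → k) i • dunklV t c i f) := by
  rw [dunklFun, descend_mk, LinearMap.sum_apply]
  simp only [LinearMap.smul_apply]

/-- The Dunkl operators, as a linear map `𝔥 → End(S𝔥^*)`, `y ↦ D_y`. -/
def dunkl (t c : k) : hSub k n →ₗ[k] Module.End k (SymHDual k n) where
  toFun := dunklFun t c
  map_add' v w := by
    refine LinearMap.ext fun q => ?_
    obtain ⟨f, rfl⟩ := mk_surj q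
    rw [LinearMap.add_apply, dunklFun_mk, dunklFun_mk, dunklFun_mk, ← map_add,
      ← Finset.sum_add_distrib]
    simp [add_smul]
  map_smul' a v := by
    refine LinearMap.ext fun q => ?_
    obtain ⟨f, rfl⟩ := mk_surj q
    rw [RingHom.id_apply, LinearMap.smul_apply, dunklFun_mk, dunklFun_mk,
      ← Ideal.Quotient.mkₐ_eq_mk k, ← map_smul, Finset.smul_sum]
    simp [mul_smul]

theorem dunkl_mk (t c : k) (v : hSub k n) (f : MvPolynomial (Fin n) k) :
    dunkl t c v (Ideal.Quotient.mk _ f)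
      = Ideal.Quotient.mk _ (∑ i, (v : Fin n → k) i • dunklV t c i f) :=
  dunklFun_mk t c v f

theorem dunkl_yDiff_mk (t c : k) (i j : Fin n) (f : MvPolynomial (Fin n) k) :
    dunkl t c (yDiff k n i j) (Ideal.Quotient.mk _ f)
      = Ideal.Quotient.mk _ (dunklV t c i f - dunklV t c j f) := by
  rw [dunkl_mk]
  congr 1
  simp [yDiff, sub_smul, Finset.sum_sub_distrib, Pi.single_apply, ite_smul]

theorem dunkl_comm (t c : k) (v w : hSub k n) :
    dunkl t c v * dunkl t c w = dunkl t c w * dunkl t c v := by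
  refine LinearMap.ext fun q => ?_
  obtain ⟨f, rfl⟩ := mk_surj q
  rw [Module.End.mul_apply, Module.End.mul_apply, dunkl_mk, dunkl_mk, dunkl_mk, dunkl_mk]
  congr 1
  simp only [map_sum, map_smul, Finset.smul_sum]
  rw [Finset.sum_comm]
  refine Finset.sum_congr rfl fun i _ => Finset.sum_congr rfl fun j _ => ?_
  rw [smul_comm, dunklV_comm]

variable (k n) in
/-- The inclusion `𝔥^* → S𝔥^*`. -/
def xLin : HDual k n →ₗ[k] SymHDual k n :=
  (Submodule.span k {(fun _ => 1 : Fin n → k)}).liftQ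
    ((Ideal.Quotient.mkₐ k (sumIdeal k n)).toLinearMap ∘ₗ
      Fintype.linearCombination k (fun i => (X i : MvPolynomial (Fin n) k))) (by
    rw [Submodule.span_le, Set.singleton_subset_iff, SetLike.mem_coe, LinearMap.mem_ker]
    simp only [LinearMap.comp_apply, Fintype.linearCombination_apply, one_smul,
      AlgHom.toLinearMap_apply, Ideal.Quotient.mkₐ_eq_mk]
    exact Ideal.Quotient.eq_zero_iff_mem.mpr (Ideal.subset_span rfl))

theorem xLin_xBar (i : Fin n) : xLin k n (xBar k n i) = Ideal.Quotient.mk (sumIdeal k n) (X i) := by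
  change Ideal.Quotient.mk (sumIdeal k n)
    (Fintype.linearCombination k (fun i => (X i : MvPolynomial (Fin n) k)) (Pi.single i 1)) = _
  rw [Fintype.linearCombination_apply_single, one_smul]

/-- How the generators act on `S𝔥^*`: `σ` naturally, `y` by `D_y`, `x` by multiplication. -/
def genOp (t c : k) : Gen k n → Module.End k (SymHDual k n)
  | .perm σ => permOp σ
  | .y v => dunkl t c v
  | .x w => LinearMap.mulLeft k (xLin k n w)

theorem genOp_rel (t c : k) ⦃a b : FreeAlgebra k (Gen k n)⦄ (h : Rel t c a b) :
    FreeAlgebra.lift k (genOp t c) a = FreeAlgebra.lift k (genOp t c) b := by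
  induction h with
  | y_add v w => simp [genOp]
  | y_smul a v => simp [genOp]
  | x_add v w => exact LinearMap.ext fun q => by simp [genOp, add_mul]
  | x_smul a v => exact LinearMap.ext fun q => by simpa [genOp] using smul_mul_assoc a _ q
  | perm_one =>
    simp only [FreeAlgebra.lift_ι_apply, genOp, map_one]
    refine LinearMap.ext fun q => ?_
    obtain ⟨f, rfl⟩ := mk_surj q
    rw [permOp_mk]
    simp
  | perm_mul σ τ =>
    simp only [FreeAlgebra.lift_ι_apply, genOp, map_mul]
    refine LinearMap.ext fun q => ?_
    obtain ⟨f, rfl⟩ := mk_surj q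
    rw [Module.End.mul_apply, permOp_mk, permOp_mk, permOp_mk, rename_rename]
    rfl
  | perm_y σ i j =>
    simp only [FreeAlgebra.lift_ι_apply, genOp, map_mul]
    refine LinearMap.ext fun q => ?_
    obtain ⟨f, rfl⟩ := mk_surj q
    rw [Module.End.mul_apply, Module.End.mul_apply, permOp_mk, dunkl_yDiff_mk, dunkl_yDiff_mk,
      permOp_mk, dunklV_rename, dunklV_rename, map_sub]
  | perm_x σ i =>
    simp only [FreeAlgebra.lift_ι_apply, genOp, map_mul]
    refine LinearMap.ext fun q => ?_
    obtain ⟨f, rfl⟩ := mk_surj q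
    rw [Module.End.mul_apply, Module.End.mul_apply, LinearMap.mulLeft_apply,
      LinearMap.mulLeft_apply, xLin_xBar, xLin_xBar, permOp_mk, ← map_mul, permOp_mk, ← map_mul,
      map_mul (rename σ), rename_X]
  | x_comm v w => exact LinearMap.ext fun q => by simp [genOp, mul_left_comm]
  | y_comm v w => simpa [genOp] using dunkl_comm t c v w
  | cross_self i j hij =>
    simp only [FreeAlgebra.lift_ι_apply, genOp, map_mul, map_sub, map_smul, map_sum,
      AlgHom.commutes]
    refine LinearMap.ext fun q => ?_
    obtain ⟨f, rfl⟩ := mk_surj q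
    simp only [LinearMap.sub_apply, Module.End.mul_apply, LinearMap.mulLeft_apply, xLin_xBar,
      LinearMap.smul_apply, LinearMap.sum_apply, permOp_mk, Module.algebraMap_end_apply]
    rw [← map_mul, dunkl_yDiff_mk, dunkl_yDiff_mk, dunklV_X_mul_self,
      dunklV_X_mul_of_ne t c j i hij, Equiv.swap_comm j i, ← map_mul, ← map_sub]
    simp only [← Ideal.Quotient.mkₐ_eq_mk k, ← map_smul, ← map_sum, ← map_sub]
    congr 1
    ring
  | cross_other i j l hi hj =>
    simp only [FreeAlgebra.lift_ι_apply, genOp, map_mul, map_sub, map_smul]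
    refine LinearMap.ext fun q => ?_
    obtain ⟨f, rfl⟩ := mk_surj q
    simp only [LinearMap.sub_apply, Module.End.mul_apply, LinearMap.mulLeft_apply, xLin_xBar,
      LinearMap.smul_apply, permOp_mk]
    rw [← map_mul, dunkl_yDiff_mk, dunkl_yDiff_mk, dunklV_X_mul_of_ne t c i l hi,
      dunklV_X_mul_of_ne t c j l hj, ← map_mul, ← map_sub]
    simp only [← Ideal.Quotient.mkₐ_eq_mk k, ← map_smul, ← map_sub]
    congr 1
    ring

variable (n) in
/-- The polynomial representation `H_{t,c}(S_n, 𝔥) → End(S𝔥^*)`. -/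
def polyRep (t c : k) : CherednikAlgebra k n t c →ₐ[k] Module.End k (SymHDual k n) :=
  RingQuot.liftAlgHom k ⟨FreeAlgebra.lift k (genOp t c), genOp_rel t c⟩

/-- The polynomial representation, as an `H_{t,c}(S_n, 𝔥)`-module structure on `S𝔥^*`. -/
instance polyModule (t c : k) : Module (CherednikAlgebra k n t c) (SymHDual k n) :=
  Module.compHom (SymHDual k n) (polyRep n t c).toRingHom

theorem cherednik_smul_def (t c : k) (a : CherednikAlgebra k n t c) (q : SymHDual k n) :
    a • q = polyRep n t c a q := rfl

instance polyModule_isScalarTower (t c : k) :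
    IsScalarTower k (CherednikAlgebra k n t c) (SymHDual k n) where
  smul_assoc a b q := by
    rw [cherednik_smul_def, cherednik_smul_def, map_smul, LinearMap.smul_apply]

end Representation

section ContravariantForm

variable {k : Type*} [Field k] {n : ℕ}

/-- The extension `S𝔥 → End(S𝔥^*)`, `f ↦ f(D)`, of `y ↦ D_y` to an algebra homomorphism. -/
def dunklHom (t c : k) : SymmetricAlgebra k (hSub k n) →ₐ[k] Module.End k (SymHDual k n) :=
  RingCon.liftₐEquiv (TensorAlgebra.symRingCon k (hSub k n)) ⟨TensorAlgebra.lift k (dunkl t c), by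
    refine RingCon.ringConGen_le.2 fun x y h => ?_
    induction h with
    | mul_comm v w =>
      rw [RingCon.ker_apply]
      simpa using dunkl_comm t c v w⟩

theorem dunklHom_ι (t c : k) (v : hSub k n) :
    dunklHom t c (SymmetricAlgebra.ι k _ v) = dunkl t c v := by
  exact TensorAlgebra.lift_ι_apply (dunkl t c) v

/-- The constant term `[x^0] q` of `q ∈ S𝔥^*`. -/
def constTerm : SymHDual k n →ₐ[k] k :=
  Ideal.Quotient.liftₐ (sumIdeal k n) (aeval (fun _ => (0 : k))) (fun f hf => by
    obtain ⟨g, rfl⟩ := Ideal.mem_span_singleton'.mp hf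
    simp)

variable (n) in
/-- The contravariant form `B(f, q) = [x^0] f(D) q` on `S𝔥 × S𝔥^*`. -/
def contravariantForm (t c : k) :
    SymmetricAlgebra k (hSub k n) →ₗ[k] SymHDual k n →ₗ[k] k :=
  (LinearMap.compRight k constTerm.toLinearMap) ∘ₗ (dunklHom t c).toLinearMap

theorem contravariantForm_apply (t c : k) (f : SymmetricAlgebra k (hSub k n))
    (q : SymHDual k n) : contravariantForm n t c f q = constTerm (dunklHom t c f q) := rfl

/-- The kernel of the contravariant form in its second argument, as a `k`-subspace. -/
def kerBSub (t c : k) : Submodule k (SymHDual k n) := LinearMap.ker (contravariantForm n t c).flip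

theorem mem_kerBSub (t c : k) (q : SymHDual k n) :
    q ∈ kerBSub t c ↔ ∀ f, contravariantForm n t c f q = 0 := by
  rw [kerBSub, LinearMap.mem_ker, LinearMap.ext_iff]
  rfl

theorem dunkl_mem_kerBSub (t c : k) (v : hSub k n) {q : SymHDual k n} (hq : q ∈ kerBSub t c) :
    dunkl t c v q ∈ kerBSub t c := by
  rw [mem_kerBSub] at hq ⊢
  intro f
  have h := hq (f * SymmetricAlgebra.ι k _ v)
  rwa [contravariantForm_apply, map_mul, dunklHom_ι, Module.End.mul_apply] at h

theorem constTerm_of_mem_kerBSub (t c : k) {q : SymHDual k n} (hq : q ∈ kerBSub t c) :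
    constTerm q = 0 := by
  have h := (mem_kerBSub t c q).mp hq 1
  rwa [contravariantForm_apply, map_one, Module.End.one_apply] at h

/-- A subspace stable under Dunkl operators and without constant terms lies in the kernel. -/
theorem le_kerBSub (t c : k) (N : Submodule k (SymHDual k n))
    (hD : ∀ i j, ∀ q ∈ N, dunkl t c (yDiff k n i j) q ∈ N)
    (h0 : ∀ q ∈ N, constTerm q = 0) : N ≤ kerBSub t c := by
  have hv : ∀ v : hSub k n, ∀ q ∈ N, dunkl t c v q ∈ N := by
    let P : Submodule k (hSub k n) :=
      { carrier := {v | ∀ q ∈ N, dunkl t c v q ∈ N}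
        add_mem' := fun {v w} hv hw q hq => by
          rw [map_add, LinearMap.add_apply]; exact N.add_mem (hv q hq) (hw q hq)
        zero_mem' := fun q _ => by rw [map_zero, LinearMap.zero_apply]; exact N.zero_mem
        smul_mem' := fun a v hv q hq => by
          rw [map_smul, LinearMap.smul_apply]; exact N.smul_mem a (hv q hq) }
    have hP : hSub k n ≤ P.map (hSub k n).subtype := by
      refine Submodule.span_le.mpr ?_
      rintro _ ⟨⟨i, j⟩, rfl⟩
      exact ⟨yDiff k n i j, hD i j, rfl⟩
    intro v
    obtain ⟨w, hw, hwv⟩ := hP v.2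
    have h : w = v := Subtype.ext hwv
    exact h ▸ hw
  have hf : ∀ f : SymmetricAlgebra k (hSub k n), ∀ q ∈ N, dunklHom t c f q ∈ N := by
    intro f
    induction f using SymmetricAlgebra.induction with
    | algebraMap r => intro q hq; rw [AlgHom.commutes]; exact N.smul_mem r hq
    | ι v => intro q hq; rw [dunklHom_ι]; exact hv v q hq
    | mul a b ha hb => intro q hq; rw [map_mul]; exact ha _ (hb q hq)
    | add a b ha hb => intro q hq; rw [map_add]; exact N.add_mem (ha q hq) (hb q hq)
  intro q hq
  rw [mem_kerBSub]
  intro f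
  exact h0 _ (hf f q hq)

theorem constTerm_mk (f : MvPolynomial (Fin n) k) :
    constTerm (Ideal.Quotient.mk (sumIdeal k n) f) = aeval (fun _ => (0 : k)) f := rfl

theorem permOp_mem_kerBSub (t c : k) (σ : Equiv.Perm (Fin n)) {q : SymHDual k n}
    (hq : q ∈ kerBSub t c) : permOp σ q ∈ kerBSub t c := by
  refine le_kerBSub t c ((kerBSub t c).map (permOp σ)) ?_ ?_ (Submodule.mem_map_of_mem hq)
  · rintro i j _ ⟨r, hr, rfl⟩
    refine ⟨_, dunkl_mem_kerBSub t c (yDiff k n (σ.symm i) (σ.symm j)) hr, ?_⟩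
    obtain ⟨f, rfl⟩ := mk_surj r
    have hi := dunklV_rename t c σ (σ.symm i) f
    have hj := dunklV_rename t c σ (σ.symm j) f
    rw [Equiv.apply_symm_apply] at hi hj
    rw [permOp_mk, dunkl_yDiff_mk, dunkl_yDiff_mk, permOp_mk, hi, hj, map_sub]
  · rintro _ ⟨r, hr, rfl⟩
    have h0 := constTerm_of_mem_kerBSub t c hr
    obtain ⟨f, rfl⟩ := mk_surj r
    rw [permOp_mk, constTerm_mk, aeval_rename]
    exact h0

theorem X_mul_mem_kerBSub (t c : k) (l : Fin n) {q : SymHDual k n}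
    (hq : q ∈ kerBSub t c) :
    Ideal.Quotient.mk (sumIdeal k n) (X l) * q ∈ kerBSub t c := by
  have hE : ∀ (i : Fin n) (f : MvPolynomial (Fin n) k),
      Ideal.Quotient.mk (sumIdeal k n) f ∈ kerBSub t c →
      ∃ e, Ideal.Quotient.mk (sumIdeal k n) e ∈ kerBSub t c ∧
        dunklV t c i (X l * f) = X l * dunklV t c i f + e := by
    intro i f hf
    have hs : ∀ σ : Equiv.Perm (Fin n),
        Ideal.Quotient.mk (sumIdeal k n) (rename σ f) ∈ kerBSub t c :=
      fun σ => permOp_mem_kerBSub t c σ hf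
    rcases eq_or_ne l i with rfl | hl
    · refine ⟨t • f - c • ∑ m ∈ Finset.univ.erase l, rename (Equiv.swap l m) f, ?_, ?_⟩
      · rw [← Ideal.Quotient.mkₐ_eq_mk k, map_sub, map_smul, map_smul, map_sum]
        exact Submodule.sub_mem _ (Submodule.smul_mem _ _ hf)
          (Submodule.smul_mem _ _ (Submodule.sum_mem _ fun m _ => hs _))
      · rw [dunklV_X_mul_self]; ring
    · refine ⟨c • rename (Equiv.swap i l) f, ?_, dunklV_X_mul_of_ne t c i l hl f⟩
      rw [← Ideal.Quotient.mkₐ_eq_mk k, map_smul]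
      exact Submodule.smul_mem _ _ (hs _)
  refine le_kerBSub t c (kerBSub t c ⊔ (kerBSub t c).map
    (LinearMap.mulLeft k (Ideal.Quotient.mk (sumIdeal k n) (X l)))) ?_ ?_
    (Submodule.mem_sup_right (Submodule.mem_map_of_mem hq))
  · intro i j r hr
    obtain ⟨a, ha, _, ⟨b, hb, rfl⟩, rfl⟩ := Submodule.mem_sup.mp hr
    have hDb := dunkl_mem_kerBSub t c (yDiff k n i j) hb
    rw [map_add]
    refine Submodule.add_mem _ (Submodule.mem_sup_left (dunkl_mem_kerBSub t c _ ha)) ?_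
    obtain ⟨f, rfl⟩ := mk_surj b
    obtain ⟨e, he, hei⟩ := hE i f hb
    obtain ⟨e', he', hej⟩ := hE j f hb
    rw [LinearMap.mulLeft_apply, ← map_mul, dunkl_yDiff_mk, hei, hej]
    rw [dunkl_yDiff_mk] at hDb
    have h : X l * dunklV t c i f + e - (X l * dunklV t c j f + e')
        = (e - e') + X l * (dunklV t c i f - dunklV t c j f) := by ring
    rw [h, map_add, map_sub, map_mul]
    exact Submodule.add_mem _ (Submodule.mem_sup_left (Submodule.sub_mem _ he he'))
      (Submodule.mem_sup_right (Submodule.mem_map_of_mem hDb))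
  · intro r hr
    obtain ⟨a, ha, _, ⟨b, hb, rfl⟩, rfl⟩ := Submodule.mem_sup.mp hr
    rw [map_add, constTerm_of_mem_kerBSub t c ha, LinearMap.mulLeft_apply, map_mul,
      constTerm_of_mem_kerBSub t c hb, mul_zero, add_zero]

theorem polyRep_mem_kerBSub (t c : k) (a : CherednikAlgebra k n t c) {q : SymHDual k n}
    (hq : q ∈ kerBSub t c) : polyRep n t c a q ∈ kerBSub t c := by
  obtain ⟨a, rfl⟩ := RingQuot.mkAlgHom_surjective k (Rel (k := k) (n := n) t c) a
  rw [polyRep, RingQuot.liftAlgHom_mkAlgHom_apply]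
  induction a using FreeAlgebra.induction generalizing q with
  | grade0 r => rw [AlgHom.commutes]; exact Submodule.smul_mem _ r hq
  | grade1 g =>
    rw [FreeAlgebra.lift_ι_apply]
    match g with
    | .perm σ => exact permOp_mem_kerBSub t c σ hq
    | .y v => exact dunkl_mem_kerBSub t c v hq
    | .x w =>
      obtain ⟨u, rfl⟩ := Submodule.Quotient.mk_surjective _ w
      have h : xLin k n (Submodule.Quotient.mk u)
          = ∑ i, u i • Ideal.Quotient.mk (sumIdeal k n) (X i) := by
        change Ideal.Quotient.mkₐ k (sumIdeal k n)
          (Fintype.linearCombination k (fun i => (X i : MvPolynomial (Fin n) k)) u) = _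
        rw [Fintype.linearCombination_apply, map_sum]
        simp only [map_smul, Ideal.Quotient.mkₐ_eq_mk]
      rw [genOp, LinearMap.mulLeft_apply, h, Finset.sum_mul]
      refine Submodule.sum_mem _ fun i _ => ?_
      rw [smul_mul_assoc]
      exact Submodule.smul_mem _ _ (X_mul_mem_kerBSub t c i hq)
  | mul a b ha hb => rw [map_mul]; exact ha (hb hq)
  | add a b ha hb => rw [map_add]; exact Submodule.add_mem _ (ha hq) (hb hq)

variable (n) in
/-- The kernel `ker B = {q ∈ S𝔥^* | B(f, q) = 0 for all f ∈ S𝔥}`, a subrepresentation of the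
polynomial representation. -/
def kerB (t c : k) : Submodule (CherednikAlgebra k n t c) (SymHDual k n) where
  carrier := {q | ∀ f, contravariantForm n t c f q = 0}
  add_mem' ha hb f := by rw [map_add, ha f, hb f, add_zero]
  zero_mem' f := map_zero _
  smul_mem' a q hq := by
    have h := polyRep_mem_kerBSub t c a ((mem_kerBSub t c q).mpr hq)
    exact (mem_kerBSub t c _).mp h

variable (n) in
/-- The quotient `L_{t,c} = S𝔥^* / ker B`, an `H_{t,c}(S_n, 𝔥)`-module. -/
abbrev IrredQuot (t c : k) : Type _ := SymHDual k n ⧸ kerB n t c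

variable (n) in
/-- The graded component `L_{t,c}[i]`: the classes of the homogeneous polynomials of degree `i`
in `x_1, …, x_n`. -/
def gradedPiece (t c : k) (i : ℕ) : Submodule k (IrredQuot n t c) :=
  (homogeneousSubmodule (Fin n) k i).map
    ((kerB n t c).mkQ.restrictScalars k ∘ₗ (Ideal.Quotient.mkₐ k (sumIdeal k n)).toLinearMap)

variable (n) in
/-- The Hilbert series `∑ dim L_{t,c}[i] z^i`. -/
def hilbertSeries (t c : k) : PowerSeries ℚ :=
  PowerSeries.mk fun i => (Module.finrank k (gradedPiece n t c i) : ℚ)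

end ContravariantForm

section Series

/-- The `z`-integer `[m]_z = (1 - z^m) / (1 - z)`. -/
def zInt (m : ℕ) : PowerSeries ℚ := (1 - PowerSeries.X ^ m) * (1 - PowerSeries.X)⁻¹

/-- The `z`-factorial `[r]_z! = [r]_z [r-1]_z ⋯ [1]_z`. -/
def zFactorial (r : ℕ) : PowerSeries ℚ := ∏ i ∈ Finset.Icc 1 r, zInt i

/-- The polynomial
`Q_r(n, z) = binom(n-1, r-1) z^(r+1) + ∑_{i=0}^r binom(n-r-2+i, i) z^i`,
where `binom(n-1, -1) = 0`. -/
def etingofRainsQ (r n : ℕ) : PowerSeries ℚ :=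
  (if r = 0 then 0 else ((n - 1).choose (r - 1) : PowerSeries ℚ)) * PowerSeries.X ^ (r + 1)
    + ∑ i ∈ Finset.range (r + 1),
      ((Ring.choose ((n : ℤ) - r - 2 + i) i : ℤ) : PowerSeries ℚ) * PowerSeries.X ^ i

/-- The series `[r]_z! [p]_z Q_r(n, z)` with `r` the residue of `n` modulo `p`, conjectured by
Etingof and Rains to be the Hilbert series of `L_{0,c}`. -/
def etingofRainsSeries (p n : ℕ) : PowerSeries ℚ :=
  zFactorial (n % p) * zInt p * etingofRainsQ (n % p) n

end Series

end RationalCherednik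

end

/-!
Dunkl operators are homogeneous of degree `-1`, so `ker B` is graded, and applying them to a
polynomial outside `ker B` as long as the result stays outside ends at a nonzero constant modulo
`ker B`; hence `L_{t,c}` is graded and simple for all `t` and `c`.

Let `t = 0`, `n = 1` in `k`, and let `u_m = 1 - e_m`. The values at `u_1, …, u_n` of a Dunkl
derivative of a homogeneous polynomial `f` depend only on the values and the degree of `f`: divided
differences at `u_m` are differences of values or of partial derivatives, and Euler's identity sums
the latter. So membership of `f` in `ker B` can be read off its value vector. In degrees below `p`
only the zero vector belongs to `ker B`, while in degree `p + d` the vectors belonging to it are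
exactly the values of polynomials of degree `d`. The Hilbert series is therefore `1 - z^p` times
that of the coordinate ring of the `n` lines through the `u_m`, whose dimensions are
`1, n - 1, n, n, …`.
-/

namespace RationalCherednik

open MvPolynomial

section Homogeneity

theorem homogeneousComponent_mul_of_isHomogeneous {σ R : Type*} [CommSemiring R]
    {f : MvPolynomial σ R} {d : ℕ} (hf : f.IsHomogeneous d) (e : ℕ) (g : MvPolynomial σ R) :
    homogeneousComponent (d + e) (f * g) = f * homogeneousComponent e g := by
  let := gradedAlgebra (σ := σ) (R := R)
  rw [← decomposition.decompose'_apply, ← decomposition.decompose'_apply]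
  exact DirectSum.coe_decompose_mul_add_of_left_mem (homogeneousSubmodule σ R) hf

theorem homogeneousComponent_pderiv {σ R : Type*} [CommSemiring R]
    (i : σ) (d : ℕ) (f : MvPolynomial σ R) :
    homogeneousComponent d (pderiv i f) = pderiv i (homogeneousComponent (d + 1) f) := by
  ext m
  simp [coeff_homogeneousComponent, coeff_pderiv]

variable {k : Type*} [Field k] {n : ℕ}

theorem homogeneousComponent_divDiff (i j : Fin n) (d : ℕ) (f : MvPolynomial (Fin n) k) :
    homogeneousComponent d (divDiff i j f) = divDiff i j (homogeneousComponent (d + 1) f) := by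
  rcases eq_or_ne i j with rfl | hij
  · simp [divDiff, divDiffFun]
  apply mul_left_cancel₀ (X_sub_X_ne_zero (k := k) i j hij)
  rw [← homogeneousComponent_mul_of_isHomogeneous ((isHomogeneous_X k i).sub (isHomogeneous_X k j)),
    divDiff_spec i j hij, divDiff_spec i j hij, map_sub, add_comm 1 d, rename_homogeneousComponent]

theorem homogeneousComponent_dunklV (t c : k) (i : Fin n) (d : ℕ) (f : MvPolynomial (Fin n) k) :
    homogeneousComponent d (dunklV t c i f) = dunklV t c i (homogeneousComponent (d + 1) f) := by
  simp only [dunklV_apply, map_sub, map_smul, map_sum, homogeneousComponent_pderiv,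
    homogeneousComponent_divDiff]

theorem isHomogeneous_dunklV (t c : k) (i : Fin n) {d : ℕ} {f : MvPolynomial (Fin n) k}
    (hf : f.IsHomogeneous (d + 1)) : (dunklV t c i f).IsHomogeneous d := by
  have h := homogeneousComponent_dunklV t c i d f
  rw [homogeneousComponent_of_mem hf, if_pos rfl] at h
  exact h ▸ homogeneousComponent_isHomogeneous d _

end Homogeneity

section Kernel

variable {k : Type*} [Field k] {n : ℕ} {t c : k}

theorem mem_kerBSub_iff_dunkl {q : SymHDual k n} :
    q ∈ kerBSub t c ↔ constTerm q = 0 ∧ ∀ i j, dunkl t c (yDiff k n i j) q ∈ kerBSub t c := by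
  refine ⟨fun hq => ⟨constTerm_of_mem_kerBSub t c hq, fun i j => dunkl_mem_kerBSub t c _ hq⟩,
    fun ⟨h0, hD⟩ => le_kerBSub t c (kerBSub t c ⊔ k ∙ q) ?_ ?_
      (Submodule.mem_sup_right (Submodule.mem_span_singleton_self q))⟩
  · intro i j r hr
    obtain ⟨u, hu, w, hw, rfl⟩ := Submodule.mem_sup.mp hr
    obtain ⟨a, rfl⟩ := Submodule.mem_span_singleton.mp hw
    rw [map_add, map_smul]
    exact Submodule.mem_sup_left (Submodule.add_mem _ (dunkl_mem_kerBSub t c _ hu)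
      (Submodule.smul_mem _ _ (hD i j)))
  · intro r hr
    obtain ⟨u, hu, w, hw, rfl⟩ := Submodule.mem_sup.mp hr
    obtain ⟨a, rfl⟩ := Submodule.mem_span_singleton.mp hw
    rw [map_add, map_smul, constTerm_of_mem_kerBSub t c hu, h0, smul_zero, add_zero]

theorem mk_mem_kerBSub_iff_dunklV {f : MvPolynomial (Fin n) k} :
    Ideal.Quotient.mk (sumIdeal k n) f ∈ kerBSub t c ↔ coeff 0 f = 0 ∧
      ∀ i j, Ideal.Quotient.mk (sumIdeal k n) (dunklV t c i f - dunklV t c j f) ∈ kerBSub t c := by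
  rw [mem_kerBSub_iff_dunkl, constTerm_mk, ← constantCoeff_eq, aeval_zero', Algebra.algebraMap_self,
    RingHom.id_apply]
  simp only [dunkl_yDiff_mk]

theorem homogeneousComponent_mem_kerBSub {f : MvPolynomial (Fin n) k}
    (hf : Ideal.Quotient.mk (sumIdeal k n) f ∈ kerBSub t c) (d : ℕ) :
    Ideal.Quotient.mk (sumIdeal k n) (homogeneousComponent d f) ∈ kerBSub t c := by
  obtain ⟨h0, hD⟩ := mk_mem_kerBSub_iff_dunklV.mp hf
  induction d generalizing f with
  | zero =>
    rw [homogeneousComponent_zero, h0, map_zero, map_zero]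
    exact Submodule.zero_mem _
  | succ d ih =>
    refine mk_mem_kerBSub_iff_dunklV.mpr ⟨by simp [coeff_homogeneousComponent], fun i j => ?_⟩
    rw [← homogeneousComponent_dunklV, ← homogeneousComponent_dunklV, ← map_sub]
    obtain ⟨h0', hD'⟩ := mk_mem_kerBSub_iff_dunklV.mp (hD i j)
    exact ih (hD i j) h0' hD'

end Kernel

section Simplicity

variable {k : Type*} [Field k] {n : ℕ} {t c : k}

theorem mem_kerB {q : SymHDual k n} : q ∈ kerB n t c ↔ q ∈ kerBSub t c :=
  (mem_kerBSub t c q).symm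

theorem one_notMem_kerB : (1 : SymHDual k n) ∉ kerB n t c := fun h =>
  one_ne_zero ((map_one constTerm).symm.trans (constTerm_of_mem_kerBSub t c (mem_kerB.mp h)))

theorem dunkl_mem {M : Submodule (CherednikAlgebra k n t c) (SymHDual k n)} (v : hSub k n)
    {q : SymHDual k n} (hq : q ∈ M) : dunkl t c v q ∈ M := by
  have h := M.smul_mem (RingQuot.mkAlgHom k (Rel t c) (gY v)) hq
  rwa [cherednik_smul_def, polyRep, RingQuot.liftAlgHom_mkAlgHom_apply,
    FreeAlgebra.lift_ι_apply] at h

theorem X_mul_mem {M : Submodule (CherednikAlgebra k n t c) (SymHDual k n)} (i : Fin n)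
    {q : SymHDual k n} (hq : q ∈ M) : Ideal.Quotient.mk (sumIdeal k n) (X i) * q ∈ M := by
  have h := M.smul_mem (RingQuot.mkAlgHom k (Rel t c) (gX (xBar k n i))) hq
  rwa [cherednik_smul_def, polyRep, RingQuot.liftAlgHom_mkAlgHom_apply, FreeAlgebra.lift_ι_apply,
    genOp, LinearMap.mulLeft_apply, xLin_xBar] at h

theorem eq_top_of_algebraMap_mem {M : Submodule (CherednikAlgebra k n t c) (SymHDual k n)}
    {a : k} (ha : a ≠ 0) (haM : algebraMap k (SymHDual k n) a ∈ M) : M = ⊤ := by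
  refine eq_top_iff.mpr fun q _ => ?_
  obtain ⟨f, rfl⟩ := mk_surj q
  induction f using MvPolynomial.induction_on with
  | C b =>
    have h : algebraMap k (SymHDual k n) (b / a) * algebraMap k (SymHDual k n) a ∈ M := by
      rw [← Algebra.smul_def]
      exact M.smul_of_tower_mem (b / a) haM
    rwa [← map_mul, div_mul_cancel₀ b ha] at h
  | add f g hf hg =>
    rw [map_add]
    exact M.add_mem (hf trivial) (hg trivial)
  | mul_X f i hf =>
    rw [map_mul, mul_comm]
    exact X_mul_mem i (hf trivial)

/-- Subtracting the constant term of `q` puts it in `ker B`. -/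
theorem eq_top_of_dunkl_mem_kerB {M : Submodule (CherednikAlgebra k n t c) (SymHDual k n)}
    (hM : kerB n t c ≤ M) {q : SymHDual k n} (hqM : q ∈ M) (hq : q ∉ kerB n t c)
    (hD : ∀ i j, dunkl t c (yDiff k n i j) q ∈ kerB n t c) : M = ⊤ := by
  have dunkl_const (v : hSub k n) (a : k) : dunkl t c v (algebraMap k (SymHDual k n) a) = 0 := by
    change dunkl t c v (Ideal.Quotient.mk _ (C a)) = 0
    simp [dunkl_mk, dunklV_C]
  have hker : q - algebraMap k _ (constTerm q) ∈ kerB n t c := by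
    refine mem_kerB.mpr (mem_kerBSub_iff_dunkl.mpr ⟨by simp, fun i j => ?_⟩)
    rw [map_sub, dunkl_const, sub_zero]
    exact mem_kerB.mp (hD i j)
  refine eq_top_of_algebraMap_mem (a := constTerm q) (fun h0 => hq ?_) ?_
  · rwa [h0, map_zero, sub_zero] at hker
  · simpa using M.sub_mem hqM (hM hker)

theorem eq_top_of_kerB_lt {M : Submodule (CherednikAlgebra k n t c) (SymHDual k n)}
    (hM : kerB n t c < M) : M = ⊤ := by
  obtain ⟨hle, q, hqM, hq⟩ := SetLike.lt_iff_le_and_exists.mp hM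
  obtain ⟨f, rfl⟩ := mk_surj q
  have hf : ∀ d ≥ f.totalDegree + 1, homogeneousComponent d f = 0 :=
    fun d hd => homogeneousComponent_eq_zero _ _ hd
  generalize f.totalDegree + 1 = D at hf
  induction D generalizing f with
  | zero =>
    have h0 : f = 0 := by
      rw [← sum_homogeneousComponent f]
      exact Finset.sum_eq_zero fun d _ => hf d d.zero_le
    exact absurd (h0 ▸ (map_zero (Ideal.Quotient.mk (sumIdeal k n))).symm ▸ zero_mem _) hq
  | succ D ih =>
    by_cases hD : ∀ i j,
        dunkl t c (yDiff k n i j) (Ideal.Quotient.mk (sumIdeal k n) f) ∈ kerB n t c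
    · exact eq_top_of_dunkl_mem_kerB hle hqM hq hD
    push Not at hD
    obtain ⟨i, j, hij⟩ := hD
    have hDM := dunkl_mem (yDiff k n i j) hqM
    rw [dunkl_yDiff_mk] at hij hDM
    refine ih _ hDM hij fun d hd => ?_
    rw [map_sub, homogeneousComponent_dunklV, homogeneousComponent_dunklV,
      hf (d + 1) (Nat.succ_le_succ hd), map_zero, map_zero, sub_zero]

variable (t c) in
theorem isSimpleModule_irredQuot :
    IsSimpleModule (CherednikAlgebra k n t c) (IrredQuot n t c) :=
  isSimpleModule_iff_isCoatom.mpr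
    ⟨fun h => one_notMem_kerB (h ▸ Submodule.mem_top), fun _ => eq_top_of_kerB_lt⟩

end Simplicity

section Grading

variable {k : Type*} [Field k] {n : ℕ} {t c : k}

variable (n t c) in
/-- The projection of `k[x_1, …, x_n]` onto `L_{t,c}`. -/
noncomputable def irredProj : MvPolynomial (Fin n) k →ₗ[k] IrredQuot n t c :=
  (kerB n t c).mkQ.restrictScalars k ∘ₗ (Ideal.Quotient.mkₐ k (sumIdeal k n)).toLinearMap

theorem irredProj_surjective : Function.Surjective (irredProj n t c) :=
  (kerB n t c).mkQ_surjective.comp mk_surj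

theorem irredProj_eq_zero_iff {f : MvPolynomial (Fin n) k} :
    irredProj n t c f = 0 ↔ Ideal.Quotient.mk (sumIdeal k n) f ∈ kerBSub t c :=
  (Submodule.Quotient.mk_eq_zero _).trans mem_kerB

theorem gradedPiece_eq_map :
    gradedPiece n t c = fun d => (homogeneousSubmodule (Fin n) k d).map (irredProj n t c) := rfl

variable (t c) in
theorem isInternal_gradedPiece : DirectSum.IsInternal (gradedPiece n t c) := by
  rw [DirectSum.isInternal_submodule_iff_iSupIndep_and_iSup_eq_top, gradedPiece_eq_map]
  constructor
  · intro d
    rw [Submodule.disjoint_def]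
    rintro _ ⟨f, hf, rfl⟩ hx
    simp only [← Submodule.map_iSup] at hx
    obtain ⟨g, hg, hgf⟩ := hx
    have hle : ⨆ e, ⨆ (_ : e ≠ d), homogeneousSubmodule (Fin n) k e
        ≤ LinearMap.ker (homogeneousComponent d) := iSup₂_le fun e he g hg => by
      rw [LinearMap.mem_ker, homogeneousComponent_of_mem hg, if_neg he.symm]
    have hgd : homogeneousComponent d g = 0 := hle hg
    have hfg : irredProj n t c (f - g) = 0 := by rw [map_sub, hgf, sub_self]
    have h := homogeneousComponent_mem_kerBSub (irredProj_eq_zero_iff.mp hfg) d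
    rw [map_sub, hgd, sub_zero, homogeneousComponent_of_mem hf, if_pos rfl] at h
    exact irredProj_eq_zero_iff.mpr h
  · refine (Submodule.map_iSup _ _).symm.trans (eq_top_iff.mpr fun x _ => ?_)
    obtain ⟨f, rfl⟩ := irredProj_surjective x
    refine Submodule.mem_map_of_mem ?_
    rw [← sum_homogeneousComponent f]
    exact Submodule.sum_mem _ fun d _ =>
      Submodule.mem_iSup_of_mem d (homogeneousComponent_isHomogeneous d f)

end Grading

section Evaluation

variable {k : Type*} [Field k] {n : ℕ}

theorem eval_divDiff_mul {i j : Fin n} (hij : i ≠ j) (a : Fin n → k) (f : MvPolynomial (Fin n) k) :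
    (a i - a j) * eval a (divDiff i j f) = eval a f - eval (a ∘ Equiv.swap i j) f := by
  simpa [eval_rename] using congrArg (eval a) (divDiff_spec i j hij f)

/-- Differentiate `(x_i - x_j) g = f - σ_ij f` with respect to `x_i` and evaluate at `a`. -/
theorem eval_divDiff_of_eq {i j : Fin n} {a : Fin n → k} (ha : a i = a j)
    (f : MvPolynomial (Fin n) k) :
    eval a (divDiff i j f) = eval a (pderiv i f) - eval a (pderiv j f) := by
  rcases eq_or_ne i j with rfl | hij
  · simp [divDiff, divDiffFun]
  have hswap : a ∘ Equiv.swap i j = a := by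
    rw [Equiv.comp_swap_eq_update, ha, Function.update_eq_self, ← ha, Function.update_eq_self]
  have hderiv := congrArg (eval a ∘ pderiv i) (divDiff_spec i j hij f)
  have hrename : pderiv i (rename (Equiv.swap i j) f) = rename (Equiv.swap i j) (pderiv j f) := by
    simpa using pderiv_rename_perm (Equiv.swap i j) j f
  simpa [Derivation.leibniz, hrename, eval_rename, hswap, ha, pderiv_X_of_ne hij.symm] using hderiv

theorem sum_erase_const (hn : (n : k) = 1) (m : Fin n) (a : k) :
    ∑ _j ∈ Finset.univ.erase m, a = 0 := by
  rw [Finset.sum_erase_eq_sub (Finset.mem_univ m)]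
  simp [hn]

/-- The point `u_m = 1 - e_m`. -/
def linePoint (m : Fin n) : Fin n → k := 1 - Pi.single m 1

theorem linePoint_self (m : Fin n) : linePoint m m = (0 : k) := by simp [linePoint]

theorem linePoint_of_ne {m j : Fin n} (h : j ≠ m) : linePoint m j = (1 : k) := by
  simp [linePoint, h]

theorem linePoint_comp_swap (m i j : Fin n) :
    (linePoint m : Fin n → k) ∘ Equiv.swap i j = linePoint (Equiv.swap i j m) := by
  funext l
  simp [linePoint, Pi.single_apply, Equiv.swap_apply_eq_iff]

variable (k n) in
/-- The values of a polynomial at the points `u_1, …, u_n`. For a homogeneous polynomial this is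
its restriction to the lines through these points. -/
noncomputable def lineValues : MvPolynomial (Fin n) k →ₗ[k] (Fin n → k) :=
  LinearMap.pi fun m => (aeval (linePoint m)).toLinearMap

theorem lineValues_apply (f : MvPolynomial (Fin n) k) (m : Fin n) :
    lineValues k n f m = eval (linePoint m) f := by
  simp [lineValues]

variable (k n) in
/-- The sum of the coordinates, as a linear functional. -/
def coordSum : (Fin n → k) →ₗ[k] k := ∑ i, LinearMap.proj i

theorem coordSum_apply (v : Fin n → k) : coordSum k n v = ∑ i, v i := by
  simp [coordSum]

/-- The operator on values at `u_1, …, u_n` induced, when `n = 1` in `k` and `t = 0`, by the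
Dunkl operator `D_{y_i}` on homogeneous polynomials of degree `d + 1`. -/
def lineDunkl (c : k) (d : ℕ) (i : Fin n) : Module.End k (Fin n → k) :=
  LinearMap.pi fun m =>
    c • if m = i then LinearMap.proj i - coordSum k n
      else (d : k) • LinearMap.proj m + LinearMap.proj i

theorem lineDunkl_apply_self (c : k) (d : ℕ) (i : Fin n) (v : Fin n → k) :
    lineDunkl c d i v i = c * (v i - ∑ j, v j) := by
  simp [lineDunkl, coordSum_apply]

theorem lineDunkl_apply_of_ne (c : k) (d : ℕ) {i m : Fin n} (h : m ≠ i) (v : Fin n → k) :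
    lineDunkl c d i v m = c * (d * v m + v i) := by
  simp [lineDunkl, h, mul_add]

theorem sum_eval_divDiff_self (hn : (n : k) = 1) (i : Fin n) (f : MvPolynomial (Fin n) k) :
    ∑ j ∈ Finset.univ.erase i, eval (linePoint i) (divDiff i j f)
      = ∑ j, lineValues k n f j - lineValues k n f i := by
  have hterm : ∀ j ∈ Finset.univ.erase i, eval (linePoint i) (divDiff i j f)
      = lineValues k n f j - lineValues k n f i := by
    intro j hj
    have hji := Finset.ne_of_mem_erase hj
    have h := eval_divDiff_mul hji.symm (linePoint i) f
    rw [linePoint_comp_swap, Equiv.swap_apply_left, linePoint_self, linePoint_of_ne hji] at h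
    rw [lineValues_apply, lineValues_apply]
    linear_combination -h
  rw [Finset.sum_congr rfl hterm, Finset.sum_sub_distrib, sum_erase_const hn, sub_zero,
    Finset.sum_erase_eq_sub (Finset.mem_univ i)]

theorem sum_erase_eval_pderiv {d : ℕ} {f : MvPolynomial (Fin n) k} (hf : f.IsHomogeneous d)
    (m : Fin n) :
    ∑ j ∈ Finset.univ.erase m, eval (linePoint m) (pderiv j f) = d * lineValues k n f m := by
  have heuler := congrArg (eval (linePoint m)) hf.sum_X_mul_pderiv
  rw [map_sum, map_nsmul, ← Finset.add_sum_erase _ _ (Finset.mem_univ m)] at heuler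
  rw [lineValues_apply, ← nsmul_eq_mul, ← heuler, map_mul, eval_X, linePoint_self, zero_mul,
    zero_add]
  refine Finset.sum_congr rfl fun j hj => ?_
  rw [map_mul, eval_X, linePoint_of_ne (Finset.ne_of_mem_erase hj), one_mul]

theorem sum_eval_divDiff_of_ne (hn : (n : k) = 1) {d : ℕ} {f : MvPolynomial (Fin n) k}
    (hf : f.IsHomogeneous d) {i m : Fin n} (hm : m ≠ i) :
    ∑ j ∈ Finset.univ.erase i, eval (linePoint m) (divDiff i j f)
      = lineValues k n f m - lineValues k n f i - d * lineValues k n f m := by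
  have hself : eval (linePoint m) (divDiff i m f) = lineValues k n f m - lineValues k n f i := by
    have h := eval_divDiff_mul hm.symm (linePoint m) f
    rwa [linePoint_comp_swap, Equiv.swap_apply_right, linePoint_self, linePoint_of_ne hm.symm,
      sub_zero, one_mul, ← lineValues_apply, ← lineValues_apply] at h
  have hother : ∀ j ∈ Finset.univ.erase m, eval (linePoint m) (divDiff i j f)
      = eval (linePoint m) (pderiv i f) - eval (linePoint m) (pderiv j f) := fun j hj =>
    eval_divDiff_of_eq
      ((linePoint_of_ne hm.symm).trans (linePoint_of_ne (Finset.ne_of_mem_erase hj)).symm) f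
  rw [Finset.sum_erase _ (by simp [divDiff, divDiffFun]),
    ← Finset.add_sum_erase _ _ (Finset.mem_univ m), hself, Finset.sum_congr rfl hother,
    Finset.sum_sub_distrib, sum_erase_const hn, sum_erase_eval_pderiv hf]
  ring

theorem lineValues_dunklV (hn : (n : k) = 1) (c : k) (i : Fin n) {d : ℕ}
    {f : MvPolynomial (Fin n) k} (hf : f.IsHomogeneous (d + 1)) :
    lineValues k n (dunklV 0 c i f) = lineDunkl c d i (lineValues k n f) := by
  funext m
  rw [lineValues_apply, dunklV_apply, zero_smul, zero_sub, map_neg, smul_eval, map_sum]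
  rcases eq_or_ne m i with rfl | hm
  · rw [sum_eval_divDiff_self hn, lineDunkl_apply_self]
    ring
  · rw [sum_eval_divDiff_of_ne hn hf hm, lineDunkl_apply_of_ne c d hm]
    push_cast
    ring

end Evaluation

section LineRadical

variable {k : Type*} [Field k] {n : ℕ}

/-- When `n = 1` in `k` and `t = 0`, the value vectors that characterize membership in `ker B` among
homogeneous polynomials of degree `d`; computed recursively from the operators `lineDunkl`. -/
def lineRadical (n : ℕ) (c : k) : ℕ → Submodule k (Fin n → k)
  | 0 => ⊥
  | d + 1 => ⨅ i, (lineRadical n c d).comap (lineDunkl c d i)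

theorem mem_lineRadical_succ {c : k} {d : ℕ} {v : Fin n → k} :
    v ∈ lineRadical n c (d + 1) ↔ ∀ i, lineDunkl c d i v ∈ lineRadical n c d := by
  simp [lineRadical]

theorem sum_lineDunkl (hn : (n : k) = 1) (c : k) (d : ℕ) (v : Fin n → k) :
    ∑ i, lineDunkl c d i v = 0 := by
  funext m
  rw [Finset.sum_apply, ← Finset.add_sum_erase _ _ (Finset.mem_univ m), lineDunkl_apply_self,
    Finset.sum_congr rfl fun i hi => lineDunkl_apply_of_ne c d (Finset.ne_of_mem_erase hi).symm v,
    ← Finset.mul_sum, Finset.sum_add_distrib, sum_erase_const hn,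
    Finset.sum_erase_eq_sub (Finset.mem_univ m), Pi.zero_apply]
  ring

/-- Average `lineDunkl c d i v - lineDunkl c d j v` over `j`. -/
theorem lineDunkl_mem_of_sub_mem (hn : (n : k) = 1) {c : k} {d : ℕ} {v : Fin n → k}
    {W : Submodule k (Fin n → k)} (h : ∀ i j, lineDunkl c d i v - lineDunkl c d j v ∈ W)
    (i : Fin n) : lineDunkl c d i v ∈ W := by
  have hsum := Submodule.sum_mem W fun j (_ : j ∈ Finset.univ) => h i j
  rwa [Finset.sum_sub_distrib, sum_lineDunkl hn, sub_zero, Finset.sum_const, Finset.card_univ,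
    Fintype.card_fin, ← Nat.cast_smul_eq_nsmul k, hn, one_smul] at hsum

theorem mk_mem_kerBSub_iff (hn : (n : k) = 1) (c : k) {d : ℕ} {f : MvPolynomial (Fin n) k}
    (hf : f.IsHomogeneous d) :
    Ideal.Quotient.mk (sumIdeal k n) f ∈ kerBSub 0 c ↔ lineValues k n f ∈ lineRadical n c d := by
  induction d generalizing f with
  | zero =>
    have : NeZero n := ⟨by rintro rfl; simp at hn⟩
    obtain ⟨a, rfl⟩ : ∃ a, f = C a :=
      ⟨_, totalDegree_eq_zero_iff_eq_C.mp ((totalDegree_zero_iff_isHomogeneous _).mpr hf)⟩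
    simp [mk_mem_kerBSub_iff_dunklV, dunklV_C, lineRadical, funext_iff, lineValues_apply]
  | succ d ih =>
    have h0 : coeff 0 f = 0 := hf.coeff_eq_zero (by simp)
    have hdiff (i j : Fin n) :=
      ih ((isHomogeneous_dunklV 0 c i hf).sub (isHomogeneous_dunklV 0 c j hf))
    simp only [map_sub, lineValues_dunklV hn c _ hf] at hdiff
    simp only [mk_mem_kerBSub_iff_dunklV, h0, true_and, map_sub, hdiff, mem_lineRadical_succ]
    exact ⟨lineDunkl_mem_of_sub_mem hn, fun h i j => Submodule.sub_mem _ (h i) (h j)⟩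

theorem coordSum_lineDunkl (hn : (n : k) = 1) (c : k) (d : ℕ) (i : Fin n) (v : Fin n → k) :
    coordSum k n (lineDunkl c d i v) = c * (d - 1) * (∑ j, v j - v i) := by
  rw [coordSum_apply, ← Finset.add_sum_erase _ _ (Finset.mem_univ i), lineDunkl_apply_self,
    Finset.sum_congr rfl fun m hm => lineDunkl_apply_of_ne c d (Finset.ne_of_mem_erase hm) v,
    ← Finset.mul_sum, Finset.sum_add_distrib, sum_erase_const hn, ← Finset.mul_sum,
    Finset.sum_erase_eq_sub (Finset.mem_univ i)]
  ring

theorem lineDunkl_eq_zero_iff (hn : (n : k) = 1) (hn1 : 1 < n) {c : k} (hc : c ≠ 0) {d : ℕ}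
    {v : Fin n → k} :
    (∀ i, lineDunkl c d i v = 0) ↔ ∃ a : k, (d + 1) * a = 0 ∧ v = fun _ => a := by
  have : Nontrivial (Fin n) := Fin.nontrivial_iff_two_le.mpr hn1
  constructor
  · intro h
    have hconst (i : Fin n) : v i = ∑ j, v j := by
      have := (lineDunkl_apply_self c d i v).symm.trans (congrFun (h i) i)
      exact sub_eq_zero.mp ((mul_eq_zero.mp this).resolve_left hc)
    obtain ⟨i, m, him⟩ := exists_pair_ne (Fin n)
    have hne := (lineDunkl_apply_of_ne c d him.symm v).symm.trans (congrFun (h i) m)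
    rw [hconst i, hconst m] at hne
    refine ⟨∑ j, v j, ?_, funext hconst⟩
    linear_combination (mul_eq_zero.mp hne).resolve_left hc
  · rintro ⟨a, ha, rfl⟩ i
    funext m
    rcases eq_or_ne m i with rfl | hm
    · simp [lineDunkl_apply_self, hn]
    · rw [lineDunkl_apply_of_ne c d hm, Pi.zero_apply]
      linear_combination c * ha

end LineRadical

section RadicalEqRange

variable {k : Type*} [Field k] {n : ℕ}

variable (k n) in
/-- The values at `u_1, …, u_n` of all homogeneous polynomials of degree `d`. -/
noncomputable def lineRange (d : ℕ) : Submodule k (Fin n → k) :=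
  (homogeneousSubmodule (Fin n) k d).map (lineValues k n)

theorem lineRange_zero : lineRange k n 0 = k ∙ (1 : Fin n → k) := by
  have h1 : lineValues k n 1 = 1 := funext fun m => by simp [lineValues_apply]
  rw [lineRange, homogeneousSubmodule_zero, Submodule.one_eq_span, Submodule.map_span,
    Set.image_singleton, h1]

theorem lineValues_X (j : Fin n) : lineValues k n (X j) = 1 - Pi.single j 1 := by
  funext m
  simp [lineValues_apply, linePoint, Pi.single_apply, eq_comm]

theorem lineRange_one (hn : (n : k) = 1) : lineRange k n 1 = LinearMap.ker (coordSum k n) := by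
  rw [lineRange, homogeneousSubmodule_one_eq_span_X, Submodule.map_span, ← Set.range_comp]
  refine le_antisymm (Submodule.span_le.mpr ?_) fun v hv => ?_
  · rintro _ ⟨j, rfl⟩
    simp [lineValues_X, coordSum_apply, hn]
  · have hcomb : v = ∑ j, -v j • (lineValues k n ∘ X) j := by
      rw [LinearMap.mem_ker, coordSum_apply] at hv
      funext m
      simp [lineValues_X, mul_sub, hv, Pi.single_apply]
    rw [hcomb]
    exact Submodule.sum_mem _ fun j _ =>
      Submodule.smul_mem _ _ (Submodule.subset_span (Set.mem_range_self j))

theorem lineRange_add_two (hn1 : 1 < n) (d : ℕ) : lineRange k n (d + 2) = ⊤ := by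
  have : Nontrivial (Fin n) := Fin.nontrivial_iff_two_le.mpr hn1
  rw [eq_top_iff, ← (Pi.basisFun k (Fin n)).span_eq, Submodule.span_le]
  rintro _ ⟨j, rfl⟩
  obtain ⟨l, hl⟩ := exists_ne j
  refine ⟨X l ^ (d + 1) * (X l - X j), ?_, funext fun m => ?_⟩
  · simpa using ((isHomogeneous_X k l).pow (d + 1)).mul
      ((isHomogeneous_X k l).sub (isHomogeneous_X k j))
  · rw [lineValues_apply, Pi.basisFun_apply]
    rcases eq_or_ne l m with rfl | hm
    · simp [linePoint_self, hl]
    · have hj : (Pi.single j 1 : Fin n → k) m = 1 - linePoint m j := by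
        simp [linePoint, Pi.single_apply, eq_comm]
      simp [linePoint_of_ne hm, hj]

variable {p : ℕ} [CharP k p]

theorem lineRadical_of_lt (hn : (n : k) = 1) (hn1 : 1 < n) {c : k} (hc : c ≠ 0) {d : ℕ}
    (hd : d < p) : lineRadical n c d = ⊥ := by
  induction d with
  | zero => rfl
  | succ d ih =>
    refine (Submodule.eq_bot_iff _).mpr fun v hv => ?_
    simp only [mem_lineRadical_succ, ih (by omega), Submodule.mem_bot] at hv
    obtain ⟨a, ha, rfl⟩ := (lineDunkl_eq_zero_iff hn hn1 hc).mp hv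
    have hd0 : ((d + 1 : ℕ) : k) ≠ 0 := fun h =>
      Nat.not_dvd_of_pos_of_lt d.succ_pos hd ((CharP.cast_eq_zero_iff k p _).mp h)
    rw [Nat.cast_succ] at hd0
    simp only [(mul_eq_zero.mp ha).resolve_left hd0]
    rfl

variable [Fact p.Prime]

theorem lineRadical_char (hn : (n : k) = 1) (hn1 : 1 < n) {c : k} (hc : c ≠ 0) :
    lineRadical n c p = k ∙ (1 : Fin n → k) := by
  obtain ⟨d, rfl⟩ := Nat.exists_eq_succ_of_ne_zero (Fact.out : p.Prime).ne_zero
  have hd : (d + 1 : k) = 0 := by exact_mod_cast CharP.cast_eq_zero k (d + 1)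
  ext v
  rw [mem_lineRadical_succ, lineRadical_of_lt (p := d + 1) hn hn1 hc d.lt_succ_self]
  simp only [Submodule.mem_bot]
  rw [lineDunkl_eq_zero_iff hn hn1 hc, Submodule.mem_span_singleton]
  simp only [hd, zero_mul, true_and]
  exact exists_congr fun a => by simp [funext_iff, eq_comm]

theorem lineRadical_char_add_one (hn : (n : k) = 1) (hn1 : 1 < n) {c : k} (hc : c ≠ 0) :
    lineRadical n c (p + 1) = LinearMap.ker (coordSum k n) := by
  have : Nontrivial (Fin n) := Fin.nontrivial_iff_two_le.mpr hn1
  ext v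
  rw [mem_lineRadical_succ, lineRadical_char hn hn1 hc, LinearMap.mem_ker, coordSum_apply]
  simp only [Submodule.mem_span_singleton]
  have hne {i m : Fin n} (hm : m ≠ i) : lineDunkl c p i v m = c * v i := by
    rw [lineDunkl_apply_of_ne c p hm, CharP.cast_eq_zero, zero_mul, zero_add]
  constructor
  · intro h
    obtain ⟨i, m, him⟩ := exists_pair_ne (Fin n)
    obtain ⟨a, ha⟩ := h i
    have hi := (congrFun ha i).trans (lineDunkl_apply_self c p i v)
    have hm := (congrFun ha m).trans (hne him.symm)
    have hsum : c * ∑ j, v j = 0 := by linear_combination hi - hm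
    exact (mul_eq_zero.mp hsum).resolve_left hc
  · refine fun h i => ⟨c * v i, funext fun m => ?_⟩
    rcases eq_or_ne m i with rfl | hm
    · simp [lineDunkl_apply_self, h]
    · simp [hne hm]

theorem lineRadical_char_add_two (hn : (n : k) = 1) (hn1 : 1 < n) {c : k} (hc : c ≠ 0) (d : ℕ) :
    lineRadical n c (p + (d + 2)) = ⊤ := by
  refine eq_top_iff.mpr fun v _ => mem_lineRadical_succ.mpr fun i => ?_
  induction d generalizing v i with
  | zero =>
    change _ ∈ lineRadical n c (p + 1)
    rw [lineRadical_char_add_one hn hn1 hc, LinearMap.mem_ker, coordSum_lineDunkl hn]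
    simp
  | succ d ih => exact mem_lineRadical_succ.mpr fun j => ih _ trivial j

theorem lineRadical_char_add (hn : (n : k) = 1) (hn1 : 1 < n) {c : k} (hc : c ≠ 0) (d : ℕ) :
    lineRadical n c (p + d) = lineRange k n d := by
  match d with
  | 0 => rw [add_zero, lineRadical_char hn hn1 hc, lineRange_zero]
  | 1 => rw [lineRadical_char_add_one hn hn1 hc, lineRange_one hn]
  | d + 2 => rw [lineRadical_char_add_two hn hn1 hc, lineRange_add_two hn1]

end RadicalEqRange

section Dimension

theorem finrank_map_mkQ_add {k V : Type*} [Field k] [AddCommGroup V] [Module k V]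
    [FiniteDimensional k V] {R W : Submodule k V} (h : R ≤ W) :
    Module.finrank k (W.map R.mkQ) + Module.finrank k R = Module.finrank k W := by
  rw [← LinearMap.finrank_range_add_finrank_ker (R.mkQ.domRestrict W), LinearMap.range_domRestrict,
    LinearMap.ker_domRestrict, Submodule.ker_mkQ, (Submodule.comapSubtypeEquivOfLe h).finrank_eq]

theorem finrank_map_add_finrank {k V A B : Type*} [Field k] [AddCommGroup V] [Module k V]
    [AddCommGroup A] [Module k A] [AddCommGroup B] [Module k B] [FiniteDimensional k B]
    {W : Submodule k V} {φ : V →ₗ[k] A} {ψ : V →ₗ[k] B} {R : Submodule k B} (hR : R ≤ W.map ψ)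
    (h : ∀ w ∈ W, φ w = 0 ↔ ψ w ∈ R) :
    Module.finrank k (W.map φ) + Module.finrank k R = Module.finrank k (W.map ψ) := by
  have hker : LinearMap.ker (φ.domRestrict W) = LinearMap.ker ((R.mkQ ∘ₗ ψ).domRestrict W) := by
    ext w
    simpa using h w w.2
  rw [← finrank_map_mkQ_add hR, ← Submodule.map_comp, ← LinearMap.range_domRestrict,
    ← LinearMap.range_domRestrict, (LinearMap.quotKerEquivRange _).symm.finrank_eq, hker,
    (LinearMap.quotKerEquivRange _).finrank_eq]

variable {k : Type*} [Field k] {n : ℕ}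

theorem finrank_lineRange_zero (hn1 : 1 < n) : Module.finrank k (lineRange k n 0) = 1 := by
  have : NeZero n := ⟨by omega⟩
  rw [lineRange_zero]
  exact finrank_span_singleton one_ne_zero

theorem finrank_lineRange_one_add_one (hn : (n : k) = 1) :
    Module.finrank k (lineRange k n 1) + 1 = n := by
  have hne : coordSum k n ≠ 0 := fun h => by
    simpa [coordSum_apply, hn] using LinearMap.congr_fun h 1
  rw [lineRange_one hn, Module.Dual.finrank_ker_add_one_of_ne_zero hne, Module.finrank_fin_fun]

theorem finrank_lineRange_add_two (hn1 : 1 < n) (d : ℕ) :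
    Module.finrank k (lineRange k n (d + 2)) = n := by
  rw [lineRange_add_two hn1, finrank_top, Module.finrank_fin_fun]

theorem lineRadical_le_lineRange (hn : (n : k) = 1) (hn1 : 1 < n) {c : k} (hc : c ≠ 0) (d : ℕ) :
    lineRadical n c d ≤ lineRange k n d := by
  match d with
  | 0 => exact bot_le
  | 1 =>
    intro v hv
    obtain ⟨a, ha, rfl⟩ := (lineDunkl_eq_zero_iff hn hn1 hc).mp (mem_lineRadical_succ.mp hv)
    obtain rfl : a = 0 := by simpa using ha
    exact Submodule.zero_mem _
  | d + 2 => exact le_top.trans_eq (lineRange_add_two hn1 d).symm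

theorem finrank_gradedPiece_add (hn : (n : k) = 1) (hn1 : 1 < n) {c : k} (hc : c ≠ 0) (d : ℕ) :
    Module.finrank k (gradedPiece n 0 c d) + Module.finrank k (lineRadical n c d)
      = Module.finrank k (lineRange k n d) :=
  finrank_map_add_finrank (φ := irredProj n 0 c) (lineRadical_le_lineRange hn hn1 hc d)
    fun _ hf => irredProj_eq_zero_iff.trans (mk_mem_kerBSub_iff hn c hf)

end Dimension

section Series

variable {k : Type*} [Field k] {n : ℕ}

variable (k n) in
/-- The series `∑ dim (lineRange d) z^d`: the Hilbert series of the homogeneous coordinate ring of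
the lines through `u_1, …, u_n`. -/
noncomputable def lineSeries : PowerSeries ℚ :=
  PowerSeries.mk fun d => (Module.finrank k (lineRange k n d) : ℚ)

theorem lineSeries_mul_one_sub_X (hn : (n : k) = 1) (hn1 : 1 < n) :
    lineSeries k n * (1 - PowerSeries.X)
      = 1 + ((n : PowerSeries ℚ) - 2) * PowerSeries.X + PowerSeries.X ^ 2 := by
  have h1 : (Module.finrank k (lineRange k n 1) : ℚ) = n - 1 :=
    eq_sub_of_add_eq (mod_cast finrank_lineRange_one_add_one hn)
  have hC : (n : PowerSeries ℚ) - 2 = PowerSeries.C ((n : ℚ) - 2) := by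
    rw [map_sub, map_natCast, map_ofNat]
  rw [hC, mul_sub, mul_one]
  ext d
  match d with
  | 0 => simp [lineSeries, finrank_lineRange_zero hn1]
  | 1 =>
    simp only [lineSeries, map_sub, map_add, PowerSeries.coeff_mk, PowerSeries.coeff_succ_mul_X,
      PowerSeries.coeff_C, PowerSeries.coeff_one, PowerSeries.coeff_X_pow,
      finrank_lineRange_zero hn1, h1]
    norm_num
    ring
  | d + 2 =>
    cases d <;> simp only [lineSeries, map_sub, map_add, PowerSeries.coeff_mk,
      PowerSeries.coeff_succ_mul_X, PowerSeries.coeff_C, PowerSeries.coeff_one,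
      PowerSeries.coeff_X_pow, finrank_lineRange_add_two hn1, h1] <;> norm_num

variable {p : ℕ} [CharP k p] [Fact p.Prime]

theorem hilbertSeries_add_X_pow_mul (hn : (n : k) = 1) (hn1 : 1 < n) {c : k} (hc : c ≠ 0) :
    hilbertSeries n 0 c + PowerSeries.X ^ p * lineSeries k n = lineSeries k n := by
  ext d
  have hdim := finrank_gradedPiece_add hn hn1 hc d
  rw [map_add, hilbertSeries, lineSeries, PowerSeries.coeff_mk, PowerSeries.coeff_X_pow_mul',
    PowerSeries.coeff_mk, PowerSeries.coeff_mk, ← hdim]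
  split_ifs with hd
  · obtain ⟨e, rfl⟩ := Nat.exists_eq_add_of_le hd
    rw [lineRadical_char_add hn hn1 hc, Nat.add_sub_cancel_left, Nat.cast_add]
  · rw [lineRadical_of_lt hn hn1 hc (not_le.mp hd), finrank_bot, add_zero, add_zero]

theorem one_sub_X_mul_inv : (1 - PowerSeries.X : PowerSeries ℚ) * (1 - PowerSeries.X)⁻¹ = 1 :=
  PowerSeries.mul_inv_cancel _ (by simp)

theorem hilbertSeries_eq (hn : (n : k) = 1) (hn1 : 1 < n) {c : k} (hc : c ≠ 0) :
    hilbertSeries n 0 c = (1 - PowerSeries.X ^ p) * (1 - PowerSeries.X)⁻¹ *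
      (1 + ((n : PowerSeries ℚ) - 2) * PowerSeries.X + PowerSeries.X ^ 2) := by
  calc hilbertSeries n 0 c = (1 - PowerSeries.X ^ p) * lineSeries k n := by
        linear_combination hilbertSeries_add_X_pow_mul (p := p) hn hn1 hc
    _ = (1 - PowerSeries.X ^ p) * (1 - PowerSeries.X)⁻¹ *
          (lineSeries k n * (1 - PowerSeries.X)) := by
        linear_combination -(1 - PowerSeries.X ^ p) * lineSeries k n * one_sub_X_mul_inv
    _ = _ := by rw [lineSeries_mul_one_sub_X hn hn1]

theorem etingofRainsQ_one (n : ℕ) :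
    etingofRainsQ 1 n = 1 + ((n : PowerSeries ℚ) - 2) * PowerSeries.X + PowerSeries.X ^ 2 := by
  simp only [etingofRainsQ, one_ne_zero, if_false, Nat.sub_self, Nat.choose_zero_right,
    Finset.sum_range_succ, Finset.sum_range_zero, Ring.choose_zero_right, Ring.choose_one_right]
  push_cast
  ring

theorem etingofRainsSeries_of_mod_eq_one {p n : ℕ} (h : n % p = 1) :
    etingofRainsSeries p n = (1 - PowerSeries.X ^ p) * (1 - PowerSeries.X)⁻¹ *
      (1 + ((n : PowerSeries ℚ) - 2) * PowerSeries.X + PowerSeries.X ^ 2) := by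
  have h1 : zFactorial 1 = 1 := by
    rw [zFactorial, Finset.Icc_self, Finset.prod_singleton, zInt, pow_one, one_sub_X_mul_inv]
  rw [etingofRainsSeries, h, h1, one_mul, etingofRainsQ_one, zInt]

end Series

end RationalCherednik

theorem theorem2p34 {k : Type*} [Field k] (p : ℕ) [Fact p.Prime] [CharP k p]
    (n : ℕ) (hn : 1 < n) (hpn : p ∣ n - 1) (c : k) (hc : c ≠ 0) :
    IsSimpleModule (RationalCherednik.CherednikAlgebra k n 0 c)
        (RationalCherednik.IrredQuot n 0 c) ∧
      DirectSum.IsInternal (RationalCherednik.gradedPiece n 0 c) ∧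
      RationalCherednik.hilbertSeries n 0 c =
        (1 - PowerSeries.X ^ p) * (1 - PowerSeries.X)⁻¹ *
          (1 + ((n : PowerSeries ℚ) - 2) * PowerSeries.X + PowerSeries.X ^ 2) ∧
      RationalCherednik.hilbertSeries n 0 c = RationalCherednik.etingofRainsSeries p n := by
  have hmod : 1 ≡ n [MOD p] := (Nat.modEq_iff_dvd' hn.le).mpr hpn
  have hnk : (n : k) = 1 := by
    simpa using ((CharP.natCast_eq_natCast k p).mpr hmod).symm
  have hr : n % p = 1 := Eq.trans hmod.symm (Nat.mod_eq_of_lt (Fact.out : p.Prime).one_lt)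
  have hH := RationalCherednik.hilbertSeries_eq (p := p) hnk hn hc
  exact ⟨RationalCherednik.isSimpleModule_irredQuot 0 c,
    RationalCherednik.isInternal_gradedPiece 0 c, hH,
    hH.trans (RationalCherednik.etingofRainsSeries_of_mod_eq_one hr).symm⟩
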